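/- Let $E$ be a separable real Banach space with norm dual $E^*$, let $I\subset\mathbb{R}$ be a compact set with Lebesgue measure and the Lebesgue $\sigma$-algebra $\mathcal{L}$, let $x:I\to E$ be measurable, and let $L:I\times E\to\mathbb{R}$ satisfy: (i) $L(\cdot,y)$ is measurable for every $y\in E$; (ii) there exist $\varepsilon>0$ and an integrable function $k:I\to\mathbb{R}$ such that $|L(t,y)-L(t,z)|\le k(t)\|y-z\|$ for every $t\in I$ and all $y,z$ in the open ball of radius $\varepsilon$ centred at $x(t)$; (iii) $L$ is a normal integrand, that is, $L$ is $\mathcal{L}\otimes\mathrm{Borel}(E)$-measurable and $L(t,\cdot)$ is lower semicontinuous on $E$ for every $t\in I$. For $\varphi:E\to\mathbb{R}$ and $\bar x,v\in E$ put $$\varphi^-(\bar x;v)=\liminf_{u\to v,\ \theta\downarrow 0}\frac{\varphi(\bar x+\theta u)-\varphi(\bar x)}{\theta}\in\mathbb{R}\cup\{\pm\infty\},\qquad \partial^-\varphi(\bar x)=\{x^*\in E^*\mid \langle x^*,v\rangle\le\varphi^-(\bar x;v)\ \forall v\in E\}$$ (the Gateaux subdifferential), and let $\partial^-_xL(t,x(t))$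 denote the Gateaux subdifferential of $L(t,\cdot)$ at $x(t)$. Assume that $\partial^-_xL(t,x(t))\neq\emptyset$ for a.e. $t\in I$. For $K\subset E^*$ and $v\in E$ let $s(v,K)=\sup_{x^*\in K}\langle x^*,v\rangle$. A function $f:I\to E^*$ is Gelfand integrable, with Gelfand integral $\int_I f\,dt=x^*\in E^*$, if for every $v\in E$ the function $\langle f(\cdot),v\rangle$ is measurable and integrable and $\langle x^*,v\rangle=\int_I\langle f(t),v\rangle\,dt$. For a multifunction $\Phi$ from $I$ to subsets of $E^*$, the Gelfand integral $\int_I\Phi(t)\,dt$ is the set of all $\int_I f\,dt$, where $f$ is Gelfand integrable with $f(t)\in\Phi(t)$ for a.e. $t\in I$; $\Phi$ is called Gelfand integrable if at least one such $f$ exists and, for every $v\in E$, the function $t\mapsto s(v,\Phi(t))$ is finite a.e. and integrable. Then the multifunction $t\mapsto\partial^-_xL(t,x(t))$ is Gelfand integrable, its Gelfand integral $\int_I\partial^-_xL(t,x(t))\,dt$ is weak$^*$ compact and convex, and $$s\Big(v,\int_I\partial^-_xL(t,x(t))\,dt\Big)=\int_I s\big(v,\partial^-_xL(t,x(t))\big)\,dt\qquad\text{for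 every } v\in E.$$ -/

import Mathlib

open MeasureTheory Filter Topology

noncomputable section

namespace GateauxGelfand

/-- Lebesgue measure on a (measurable) subset `I` of the real line. -/
def lebesgueOn (I : Set ℝ) : Measure I :=
  Measure.comap (Subtype.val : I → ℝ) volume

/-- The lower directional derivative
`liminf_{u → v, θ ↓ 0} (φ (x + θ u) - φ x) / θ`, an extended real number. -/
def lowerDirDeriv {E : Type*} [NormedAddCommGroup E] [NormedSpace ℝ E]
    (φ : E → ℝ) (x v : E) : EReal :=
  liminf (fun p : E × ℝ => (((φ (x + p.2 • p.1) - φ x) / p.2 : ℝ) : EReal))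
    (𝓝 v ×ˢ 𝓝[>] (0 : ℝ))

/-- The Gateaux subdifferential of `φ` at `x`, as a subset of the dual with its weak* topology. -/
def gateauxSubdiff {E : Type*} [NormedAddCommGroup E] [NormedSpace ℝ E]
    (φ : E → ℝ) (x : E) : Set (WeakDual ℝ E) :=
  {ξ | ∀ v : E, ((ξ v : ℝ) : EReal) ≤ lowerDirDeriv φ x v}

/-- The support function `s(v, K) = sup_{ξ ∈ K} ⟨ξ, v⟩`, an extended real number. -/
def supportFn {E : Type*} [NormedAddCommGroup E] [NormedSpace ℝ E]
    (v : E) (K : Set (WeakDual ℝ E)) : EReal :=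
  ⨆ ξ ∈ K, ((ξ v : ℝ) : EReal)

/-- A (real-valued) normal integrand: jointly measurable for the product of the `μ`-completed
σ-algebra of `T` with the Borel σ-algebra of `E`, and lower semicontinuous in the second variable.
For `T ⊆ ℝ` with Lebesgue measure, the completed σ-algebra is the Lebesgue σ-algebra. -/
structure IsNormalIntegrand {T E : Type*} [MeasurableSpace T] [NormedAddCommGroup E]
    [MeasurableSpace E] (μ : Measure T) (L : T → E → ℝ) : Prop where
  measurable : Measurable (fun p : NullMeasurableSpace T μ × E => L p.1 p.2)
  lowerSemicontinuous : ∀ t : T, LowerSemicontinuous (L t)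

/-- `f` is weak* scalarly measurable (for the completed σ-algebra). -/
def WeakStarScalarlyMeasurable {T E : Type*} [MeasurableSpace T] [NormedAddCommGroup E]
    [NormedSpace ℝ E] (μ : Measure T) (f : T → WeakDual ℝ E) : Prop :=
  ∀ v : E, NullMeasurable (fun t => f t v) μ

/-- `f` is Gelfand integrable with Gelfand integral `ξ`: `⟨ξ, v⟩ = ∫ ⟨f t, v⟩ dμ` for all `v`,
all these scalar integrals being convergent. -/
def HasGelfandIntegral {T E : Type*} [MeasurableSpace T] [NormedAddCommGroup E]
    [NormedSpace ℝ E] (μ : Measure T) (f : T → WeakDual ℝ E) (ξ : WeakDual ℝ E) : Prop :=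
  WeakStarScalarlyMeasurable μ f ∧
    ∀ v : E, Integrable (fun t => f t v) μ ∧ ξ v = ∫ t, f t v ∂μ

/-- The set of Gelfand integrable (almost everywhere) selectors of a multifunction. -/
def gelfandSelectors {T E : Type*} [MeasurableSpace T] [NormedAddCommGroup E]
    [NormedSpace ℝ E] (μ : Measure T) (Φ : T → Set (WeakDual ℝ E)) : Set (T → WeakDual ℝ E) :=
  {f | (∀ᵐ t ∂μ, f t ∈ Φ t) ∧ ∃ ξ, HasGelfandIntegral μ f ξ}

/-- The Gelfand integral of a multifunction: the set of the Gelfand integrals of its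
Gelfand integrable selectors. -/
def gelfandIntegral {T E : Type*} [MeasurableSpace T] [NormedAddCommGroup E]
    [NormedSpace ℝ E] (μ : Measure T) (Φ : T → Set (WeakDual ℝ E)) : Set (WeakDual ℝ E) :=
  {ξ | ∃ f ∈ gelfandSelectors μ Φ, HasGelfandIntegral μ f ξ}

/-- A multifunction is Gelfand integrable if it has a Gelfand integrable selector and, for
every `v`, the scalar function `t ↦ s(v, Φ t)` is finite almost everywhere and integrable. -/
structure GelfandIntegrable {T E : Type*} [MeasurableSpace T] [NormedAddCommGroup E]
    [NormedSpace ℝ E] (μ : Measure T) (Φ : T → Set (WeakDual ℝ E)) : Prop where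
  nonempty_selectors : (gelfandSelectors μ Φ).Nonempty
  support_finite : ∀ v : E, ∀ᵐ t ∂μ, supportFn v (Φ t) ≠ ⊥ ∧ supportFn v (Φ t) ≠ ⊤
  support_integrable : ∀ v : E, Integrable (fun t => (supportFn v (Φ t)).toReal) μ

end GateauxGelfand

end

namespace GateauxGelfand

/-! ### Sublinear functions, their faces and measurable extreme functionals. -/

section Sublinear

variable {E : Type*} [NormedAddCommGroup E] [NormedSpace ℝ E]

/-- Subadditive functions bounded above by `K‖·‖` and superhomogeneous for natural factors. -/
structure IsSublinear (K : ℝ) (p : E → ℝ) : Prop where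
  add_le : ∀ v w, p (v + w) ≤ p v + p w
  le_norm : ∀ v, p v ≤ K * ‖v‖
  nat_mul_le : ∀ (j : ℕ) v, j * p v ≤ p ((j : ℝ) • v)

/-- `K`-Lipschitz functions vanishing at `0` and superhomogeneous for natural factors. -/
structure IsDirectional (K : ℝ) (q : E → ℝ) : Prop where
  lip : ∀ v w, q w ≤ q v + K * ‖w - v‖
  map_zero : q 0 = 0
  nat_mul_le : ∀ (j : ℕ) v, j * q v ≤ q ((j : ℝ) • v)

theorem continuous_of_subadditive {E : Type*} [NormedAddCommGroup E] {G : E → ℝ} {K : ℝ}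
    (hsub : ∀ v w, G (v + w) ≤ G v + G w) (hle : ∀ w, G w ≤ K * ‖w‖) : Continuous G := by
  refine (LipschitzWith.of_le_add_mul' K fun v w => ?_).continuous
  have h := hsub w (v - w)
  rw [add_sub_cancel] at h
  rw [dist_eq_norm]
  linarith [hle (v - w)]

/-- A subadditive function bounded by a multiple of the norm which is odd on a dense set
is a continuous linear functional. -/
theorem exists_weakDual_eq_of_subadditive {G : E → ℝ} {K : ℝ} {S : Set E} (hS : Dense S)
    (hsub : ∀ v w, G (v + w) ≤ G v + G w) (hle : ∀ w, G w ≤ K * ‖w‖)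
    (hodd : ∀ d ∈ S, G d + G (-d) ≤ 0) : ∃ ξ : WeakDual ℝ E, ∀ w, ξ w = G w := by
  have hc := continuous_of_subadditive hsub hle
  have hodd' : ∀ w, G w + G (-w) ≤ 0 := by
    have hcl : IsClosed {w | G w + G (-w) ≤ 0} :=
      isClosed_le (hc.add (hc.comp continuous_neg)) continuous_const
    intro w
    have := hcl.closure_subset_iff.2 (show S ⊆ _ from hodd)
    exact this (hS w)
  have hadd : ∀ v w, G (v + w) = G v + G w := by
    intro v w
    refine le_antisymm (hsub v w) ?_
    have h := hsub (v + w) (-w)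
    rw [add_neg_cancel_right] at h
    linarith [hodd' w]
  -- Continuous additive maps are real linear, so homogeneity for natural factors is all that is
  -- ever required.
  refine ⟨StrongDual.toWeakDual ((AddMonoidHom.mk' G hadd).toRealLinearMap hc), fun w => rfl⟩

namespace IsSublinear

variable {K : ℝ} {p : E → ℝ}

theorem map_zero (hp : IsSublinear K p) : p 0 = 0 := by
  have h1 := hp.le_norm 0
  have h2 := hp.nat_mul_le 0 0
  simp at h1 h2
  linarith

theorem neg_le (hp : IsSublinear K p) (v : E) : -p (-v) ≤ p v := by
  have h := hp.add_le v (-v)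
  rw [add_neg_cancel, hp.map_zero] at h
  linarith

theorem neg_norm_le (hp : IsSublinear K p) (v : E) : -(K * ‖v‖) ≤ p v := by
  have h := hp.le_norm (-v)
  rw [norm_neg] at h
  linarith [hp.neg_le v]

theorem map_nat_smul_le (hp : IsSublinear K p) (j : ℕ) (v : E) :
    p ((j : ℝ) • v) ≤ j * p v := by
  induction j with
  | zero => simp [hp.map_zero]
  | succ j ih =>
    have h := hp.add_le ((j : ℝ) • v) v
    push_cast
    rw [add_smul, one_smul]
    linarith

end IsSublinear

/-- The support function of the face of `{ξ ≤ p}` on which `ξ v` is maximal. -/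
noncomputable def faceFn (p : E → ℝ) (v w : E) : ℝ :=
  ⨅ m : ℕ, (p (w + (m : ℝ) • v) - m * p v)

section Face

variable {K : ℝ} {p : E → ℝ}

/-- The bound does not depend on `m`, so the infimum defining the face function is finite. -/
theorem neg_le_faceFn_term (hp : IsSublinear K p) (v w : E) (m : ℕ) :
    -p (-w) ≤ p (w + (m : ℝ) • v) - m * p v := by
  have h := hp.add_le (w + (m : ℝ) • v) (-w)
  rw [add_neg_cancel_comm] at h
  linarith [hp.nat_mul_le m v]

theorem faceFn_le (hp : IsSublinear K p) (v w : E) (m : ℕ) :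
    faceFn p v w ≤ p (w + (m : ℝ) • v) - m * p v :=
  ciInf_le ⟨-p (-w), by rintro _ ⟨m, rfl⟩; exact neg_le_faceFn_term hp v w m⟩ m

theorem faceFn_le_self (hp : IsSublinear K p) (v w : E) : faceFn p v w ≤ p w := by
  simpa using faceFn_le hp v w 0

/-- This is what passing to the face gains: the new function is odd at `v`, so its minorants all
take the value `p v` there. -/
theorem faceFn_neg_le (hp : IsSublinear K p) (v : E) : faceFn p v (-v) ≤ -p v := by
  simpa [hp.map_zero] using faceFn_le hp v (-v) 1

theorem IsSublinear.faceFn (hp : IsSublinear K p) (v : E) : IsSublinear K (faceFn p v) where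
  add_le w w' := by
    refine le_ciInf_add_ciInf fun m m' => ?_
    refine (faceFn_le hp v (w + w') (m + m')).trans ?_
    have h := hp.add_le (w + (m : ℝ) • v) (w' + (m' : ℝ) • v)
    rw [show w + (m : ℝ) • v + (w' + (m' : ℝ) • v) = w + w' + ((m + m' : ℕ) : ℝ) • v by
      push_cast; module] at h
    push_cast at h ⊢
    linarith
  le_norm w := (faceFn_le_self hp v w).trans (hp.le_norm w)
  nat_mul_le j w := by
    refine le_ciInf fun m => ?_
    rcases Nat.eq_zero_or_pos j with rfl | hj
    · simpa using hp.nat_mul_le m v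
    · have h1 := faceFn_le hp v w m
      have h2 := hp.nat_mul_le j (w + (m : ℝ) • v)
      -- Multiplying the `m`-th term by `j` yields `j * m` copies of `v`, where only `m` are wanted;
      -- subadditivity splits off the surplus `i * m`.
      obtain ⟨i, rfl⟩ : ∃ i, j = i + 1 := ⟨j - 1, by omega⟩
      have h3 := hp.add_le (((i + 1 : ℕ) : ℝ) • w + (m : ℝ) • v) (((i * m : ℕ) : ℝ) • v)
      have h4 := hp.map_nat_smul_le (i * m) v
      have h5 : ((i + 1 : ℕ) : ℝ) * GateauxGelfand.faceFn p v w
          ≤ ((i + 1 : ℕ) : ℝ) * (p (w + (m : ℝ) • v) - m * p v) :=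
        mul_le_mul_of_nonneg_left h1 (Nat.cast_nonneg _)
      rw [show ((i + 1 : ℕ) : ℝ) • w + (m : ℝ) • v + ((i * m : ℕ) : ℝ) • v
        = ((i + 1 : ℕ) : ℝ) • (w + (m : ℝ) • v) by push_cast; module] at h3
      push_cast at *
      linarith

/-- Iterated faces along a sequence of directions. -/
noncomputable def faceSeq (p : E → ℝ) (e : ℕ → E) : ℕ → E → ℝ
  | 0 => p
  | n + 1 => faceFn (faceSeq p e n) (e n)

theorem IsSublinear.faceSeq (hp : IsSublinear K p) (e : ℕ → E) (n : ℕ) :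
    IsSublinear K (faceSeq p e n) := by
  induction n with
  | zero => exact hp
  | succ n ih => exact ih.faceFn (e n)

theorem faceSeq_antitone (hp : IsSublinear K p) (e : ℕ → E) (w : E) :
    Antitone fun n => faceSeq p e n w :=
  antitone_nat_of_succ_le fun n => faceFn_le_self (hp.faceSeq e n) (e n) w

theorem ciInf_faceSeq_le (hp : IsSublinear K p) (e : ℕ → E) (n : ℕ) (w : E) :
    ⨅ n, faceSeq p e n w ≤ faceSeq p e n w :=
  ciInf_le ⟨-(K * ‖w‖), by rintro _ ⟨m, rfl⟩; exact (hp.faceSeq e m).neg_norm_le w⟩ n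

/-- Iterating the faces along a sequence with dense range leaves a single functional. -/
theorem exists_weakDual_eq_ciInf_faceSeq (hp : IsSublinear K p) {e : ℕ → E}
    (he : DenseRange e) : ∃ ξ : WeakDual ℝ E, (∀ w, ξ w = ⨅ n, faceSeq p e n w) ∧
      (∀ w, ξ w ≤ p w) ∧ ξ (e 0) = p (e 0) := by
  -- Step `n` makes the function odd at `e n` and later steps only decrease it, so the infimum is
  -- odd on a dense set.
  have hodd : ∀ n, (⨅ m, faceSeq p e m (-e n)) ≤ -faceSeq p e n (e n) := fun n =>
    (ciInf_faceSeq_le hp e (n + 1) (-e n)).trans (faceFn_neg_le (hp.faceSeq e n) (e n))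
  obtain ⟨ξ, hξ⟩ := exists_weakDual_eq_of_subadditive
    (G := fun w => ⨅ n, faceSeq p e n w) (K := K) he
    (fun v w => by
      refine le_ciInf_add_ciInf fun m m' => ?_
      refine (ciInf_faceSeq_le hp e (max m m') (v + w)).trans ?_
      refine ((hp.faceSeq e _).add_le v w).trans (add_le_add ?_ ?_)
      · exact faceSeq_antitone hp e v (le_max_left _ _)
      · exact faceSeq_antitone hp e w (le_max_right _ _))
    (fun w => (ciInf_faceSeq_le hp e 0 w).trans (hp.le_norm w))
    (by
      rintro _ ⟨n, rfl⟩
      linarith [ciInf_faceSeq_le hp e n (e n), hodd n])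
  have hle : ∀ w, ξ w ≤ p w := fun w => (hξ w).trans_le (ciInf_faceSeq_le hp e 0 w)
  refine ⟨ξ, hξ, hle, le_antisymm (hle _) ?_⟩
  have h := hodd 0
  rw [← hξ, map_neg] at h
  simpa [faceSeq] using h

end Face

/-! ### The largest sublinear minorant as a countable infimum. -/

section Hull

variable {K : ℝ} {q : E → ℝ} {ξ : WeakDual ℝ E}

theorem IsDirectional.continuous (hq : IsDirectional K q) : Continuous q :=
  (LipschitzWith.of_le_add_mul' K fun v w => by
    rw [dist_eq_norm]; exact hq.lip w v).continuous

theorem le_add_of_le (hξ : ∀ w, ξ w ≤ q w) (v d : E) : ξ v ≤ q d + q (v - d) := by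
  have h : ξ v = ξ d + ξ (v - d) := by rw [← map_add, add_sub_cancel]
  rw [h]
  exact add_le_add (hξ d) (hξ _)

variable [TopologicalSpace.SeparableSpace E]

/-- The infimal convolution of `q` with itself, the infimum being over a dense sequence. -/
noncomputable def infConv (q : E → ℝ) (v : E) : ℝ :=
  ⨅ i : ℕ, (q (TopologicalSpace.denseSeq E i) + q (v - TopologicalSpace.denseSeq E i))

theorem le_infConv (hξ : ∀ w, ξ w ≤ q w) (v : E) : ξ v ≤ infConv q v :=
  le_ciInf fun _ => le_add_of_le hξ _ _

/-- By continuity of `q`, the infimum over the dense sequence is the infimum over all of `E`. The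
minorant `ξ` keeps it finite. -/
theorem infConv_le_add (hq : IsDirectional K q) (hξ : ∀ w, ξ w ≤ q w) (v d : E) :
    infConv q v ≤ q d + q (v - d) := by
  have hcl : IsClosed {d | infConv q v ≤ q d + q (v - d)} :=
    isClosed_le continuous_const
      (hq.continuous.add (hq.continuous.comp (continuous_const.sub continuous_id)))
  refine hcl.closure_subset_iff.2 ?_ (TopologicalSpace.denseRange_denseSeq E d)
  rintro _ ⟨i, rfl⟩
  exact ciInf_le ⟨ξ v, by rintro _ ⟨j, rfl⟩; exact le_add_of_le hξ _ _⟩ i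

theorem infConv_le_self (hq : IsDirectional K q) (hξ : ∀ w, ξ w ≤ q w) (v : E) :
    infConv q v ≤ q v := by
  simpa [hq.map_zero] using infConv_le_add hq hξ v 0

theorem IsDirectional.infConv (hq : IsDirectional K q) (hξ : ∀ w, ξ w ≤ q w) :
    IsDirectional K (infConv q) where
  lip v w := by
    rw [← sub_le_iff_le_add]
    refine le_ciInf fun i => ?_
    have h1 := infConv_le_add hq hξ w (TopologicalSpace.denseSeq E i)
    have h2 := hq.lip (v - TopologicalSpace.denseSeq E i) (w - TopologicalSpace.denseSeq E i)
    rw [sub_sub_sub_cancel_right] at h2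
    linarith
  map_zero := by
    refine le_antisymm ((infConv_le_self hq hξ 0).trans hq.map_zero.le) ?_
    simpa using le_infConv hξ 0
  nat_mul_le j v := by
    refine le_ciInf fun i => ?_
    set d := TopologicalSpace.denseSeq E i
    rcases Nat.eq_zero_or_pos j with rfl | hj
    · simpa using le_add_of_le hξ 0 d
    · have hj' : (j : ℝ) ≠ 0 := by positivity
      -- A splitting `d + (j v - d)` of `j v` is `j` times a splitting of `v`; its point `d / j`
      -- need not belong to the dense sequence.
      have h1 := hq.nat_mul_le j ((j : ℝ)⁻¹ • d)
      have h2 := hq.nat_mul_le j (v - (j : ℝ)⁻¹ • d)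
      rw [smul_sub] at h2
      rw [smul_inv_smul₀ hj'] at h1 h2
      have h3 := mul_le_mul_of_nonneg_left (infConv_le_add hq hξ v ((j : ℝ)⁻¹ • d))
        (Nat.cast_nonneg j : (0 : ℝ) ≤ j)
      linarith

/-- The iterated infimal convolutions of `q` with itself. -/
noncomputable def infConvSeq (q : E → ℝ) : ℕ → E → ℝ
  | 0 => q
  | n + 1 => infConv (infConvSeq q n)

/-- The largest sublinear function below `q`. -/
noncomputable def sublinearHull (q : E → ℝ) (v : E) : ℝ := ⨅ n, infConvSeq q n v

theorem le_infConvSeq (hξ : ∀ w, ξ w ≤ q w) (n : ℕ) : ∀ w, ξ w ≤ infConvSeq q n w := by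
  induction n with
  | zero => exact hξ
  | succ n ih => exact le_infConv ih

theorem IsDirectional.infConvSeq (hq : IsDirectional K q) (hξ : ∀ w, ξ w ≤ q w) (n : ℕ) :
    IsDirectional K (infConvSeq q n) := by
  induction n with
  | zero => exact hq
  | succ n ih => exact ih.infConv (le_infConvSeq hξ n)

theorem infConvSeq_antitone (hq : IsDirectional K q) (hξ : ∀ w, ξ w ≤ q w) (v : E) :
    Antitone fun n => infConvSeq q n v :=
  antitone_nat_of_succ_le fun n =>
    infConv_le_self (hq.infConvSeq hξ n) (le_infConvSeq hξ n) v

theorem le_sublinearHull (hξ : ∀ w, ξ w ≤ q w) (w : E) : ξ w ≤ sublinearHull q w :=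
  le_ciInf fun n => le_infConvSeq hξ n w

theorem sublinearHull_le_infConvSeq (hξ : ∀ w, ξ w ≤ q w) (n : ℕ) (v : E) :
    sublinearHull q v ≤ infConvSeq q n v :=
  ciInf_le ⟨ξ v, by rintro _ ⟨m, rfl⟩; exact le_infConvSeq hξ m v⟩ n

theorem sublinearHull_le (hξ : ∀ w, ξ w ≤ q w) (v : E) : sublinearHull q v ≤ q v :=
  sublinearHull_le_infConvSeq hξ 0 v

/-- Subadditivity appears in the limit because the convolution of index `n + 1` at `v + w` is at
most the sum of those of index `n` at `v` and `w`. -/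
theorem isSublinear_sublinearHull (hq : IsDirectional K q) (hξ : ∀ w, ξ w ≤ q w) :
    IsSublinear K (sublinearHull q) where
  add_le v w := by
    refine le_ciInf_add_ciInf fun m m' => ?_
    set n := max m m'
    have h := infConv_le_add (hq.infConvSeq hξ n) (le_infConvSeq hξ n) (v + w) v
    rw [add_sub_cancel_left] at h
    refine (sublinearHull_le_infConvSeq hξ (n + 1) (v + w)).trans
      (h.trans (add_le_add ?_ ?_))
    · exact infConvSeq_antitone hq hξ v (le_max_left _ _)
    · exact infConvSeq_antitone hq hξ w (le_max_right _ _)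
  le_norm v := by
    refine (sublinearHull_le hξ v).trans ?_
    simpa [hq.map_zero] using hq.lip 0 v
  nat_mul_le j v := by
    refine le_ciInf fun n => ?_
    refine le_trans ?_ ((hq.infConvSeq hξ n).nat_mul_le j v)
    exact mul_le_mul_of_nonneg_left (sublinearHull_le_infConvSeq hξ n v) (Nat.cast_nonneg j)

end Hull

/-! ### Measurable dependence of faces and hulls on a parameter. -/

section Measurability

variable {T : Type*} [MeasurableSpace T]

theorem measurable_faceSeq {P : T → E → ℝ} (hP : ∀ v, Measurable fun t => P t v) (e : ℕ → E) (n : ℕ) :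
    ∀ w, Measurable fun t => faceSeq (P t) e n w := by
  induction n with
  | zero => exact hP
  | succ n ih =>
    intro w
    exact Measurable.iInf fun m => (ih _).sub ((ih _).const_mul _)

theorem measurable_sublinearHull {E : Type*} [NormedAddCommGroup E]
    [TopologicalSpace.SeparableSpace E] {P : T → E → ℝ} (hP : ∀ v, Measurable fun t => P t v) (v : E) :
    Measurable fun t => sublinearHull (P t) v := by
  have h : ∀ n v, Measurable fun t => infConvSeq (P t) n v := by
    intro n
    induction n with
    | zero => exact hP
    | succ n ih =>
      intro w
      exact Measurable.iInf fun m => (ih _).add (ih _)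
  exact Measurable.iInf fun n => h n v

end Measurability

end Sublinear

end GateauxGelfand

namespace GateauxGelfand

/-! ### The lower directional derivative of a locally Lipschitz function. -/

section Dini

variable {E : Type*} [NormedAddCommGroup E] [NormedSpace ℝ E]

/-- `φ` is Lipschitz with constant `K` on the open ball of radius `ε` about `x`. -/
def LipschitzNear (φ : E → ℝ) (x : E) (ε K : ℝ) : Prop :=
  0 < ε ∧ ∀ y ∈ Metric.ball x ε, ∀ z ∈ Metric.ball x ε, |φ y - φ z| ≤ K * ‖y - z‖

/-- The difference quotient in direction `p.1` with step `p.2`. -/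
noncomputable def diffQuot (φ : E → ℝ) (x : E) (p : E × ℝ) : ℝ :=
  (φ (x + p.2 • p.1) - φ x) / p.2

theorem lowerDirDeriv_eq (φ : E → ℝ) (x v : E) :
    lowerDirDeriv φ x v = liminf (fun p => (diffQuot φ x p : EReal)) (𝓝 v ×ˢ 𝓝[>] (0 : ℝ)) :=
  rfl

variable {φ : E → ℝ} {x : E} {ε K : ℝ}

theorem lt_lowerDirDeriv_imp {v : E} {r : ℝ} (h : (r : EReal) < lowerDirDeriv φ x v) :
    ∀ᶠ p in 𝓝 v ×ˢ 𝓝[>] (0 : ℝ), r < diffQuot φ x p := by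
  filter_upwards [eventually_lt_of_lt_liminf h] with p hp
  exact EReal.coe_lt_coe_iff.1 hp

theorem le_lowerDirDeriv {v : E} {r : ℝ}
    (h : ∀ᶠ p in 𝓝 v ×ˢ 𝓝[>] (0 : ℝ), r ≤ diffQuot φ x p) :
    (r : EReal) ≤ lowerDirDeriv φ x v :=
  le_liminf_of_le (by isBoundedDefault) (h.mono fun p hp => EReal.coe_le_coe_iff.2 hp)

theorem eventually_pos_prod {E : Type*} [NormedAddCommGroup E] (v : E) : ∀ᶠ p in 𝓝 v ×ˢ 𝓝[>] (0 : ℝ), 0 < p.2 :=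
  tendsto_snd.eventually self_mem_nhdsWithin

theorem eventually_mem_ball (hε : 0 < ε) (v : E) :
    ∀ᶠ p in 𝓝 v ×ˢ 𝓝[>] (0 : ℝ), x + p.2 • p.1 ∈ Metric.ball x ε := by
  have h : Tendsto (fun p : E × ℝ => x + p.2 • p.1) (𝓝 v ×ˢ 𝓝[>] (0 : ℝ)) (𝓝 x) := by
    have hc : Continuous fun p : E × ℝ => x + p.2 • p.1 := by fun_prop
    have h1 := hc.tendsto (v, 0)
    rw [nhds_prod_eq] at h1
    simp only [zero_smul, add_zero] at h1
    exact h1.mono_left (prod_mono le_rfl nhdsWithin_le_nhds)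
  exact h (Metric.ball_mem_nhds x hε)

theorem abs_diffQuot_sub_le (hφ : LipschitzNear φ x ε K) {u u' : E} {θ : ℝ} (hθ : 0 < θ)
    (hu : x + θ • u ∈ Metric.ball x ε) (hu' : x + θ • u' ∈ Metric.ball x ε) :
    |diffQuot φ x (u, θ) - diffQuot φ x (u', θ)| ≤ K * ‖u - u'‖ := by
  have h := hφ.2 _ hu _ hu'
  rw [add_sub_add_left_eq_sub, ← smul_sub, norm_smul, Real.norm_of_nonneg hθ.le] at h
  unfold diffQuot
  dsimp only
  rw [← sub_div, sub_sub_sub_cancel_right, abs_div, abs_of_pos hθ, div_le_iff₀ hθ]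
  linarith

theorem abs_diffQuot_le (hφ : LipschitzNear φ x ε K) {u : E} {θ : ℝ} (hθ : 0 < θ)
    (hu : x + θ • u ∈ Metric.ball x ε) : |diffQuot φ x (u, θ)| ≤ K * ‖u‖ := by
  have h := abs_diffQuot_sub_le hφ (u' := 0) hθ hu (by simpa using hφ.1)
  simpa [diffQuot] using h

/-- Translating `u` by `w - v` carries a neighbourhood of `v` to one of `w` and changes the
difference quotient by at most `K * ‖w - v‖`. A real `r` avoids extended arithmetic before
finiteness is known. -/
theorem lowerDirDeriv_le_add (hφ : LipschitzNear φ x ε K) {v w : E} {r : ℝ}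
    (h : (r : EReal) < lowerDirDeriv φ x w) :
    ((r - K * ‖w - v‖ : ℝ) : EReal) ≤ lowerDirDeriv φ x v := by
  have ht : Tendsto (fun p : E × ℝ => (p.1 + (w - v), p.2)) (𝓝 v ×ˢ 𝓝[>] (0 : ℝ))
      (𝓝 w ×ˢ 𝓝[>] (0 : ℝ)) := by
    refine Tendsto.prodMk ?_ tendsto_snd
    have h1 : Tendsto (fun u : E => u + (w - v)) (𝓝 v) (𝓝 (v + (w - v))) :=
      (continuous_add_const _).tendsto _
    rw [add_sub_cancel] at h1
    exact h1.comp tendsto_fst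
  apply le_lowerDirDeriv
  filter_upwards [ht.eventually (lt_lowerDirDeriv_imp h), eventually_pos_prod v,
    eventually_mem_ball hφ.1 v, ht.eventually (eventually_mem_ball hφ.1 w)] with p h1 h2 h3 h4
  have h5 := abs_diffQuot_sub_le hφ h2 h4 h3
  rw [add_sub_cancel_left] at h5
  linarith [(abs_le.1 h5).2]

theorem lowerDirDeriv_zero (hφ : LipschitzNear φ x ε K) : lowerDirDeriv φ x 0 = 0 := by
  have hb : ∀ η : ℝ, 0 < η → ∀ᶠ p in 𝓝 (0 : E) ×ˢ 𝓝[>] (0 : ℝ), |diffQuot φ x p| ≤ η := by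
    intro η hη
    have h0 : Tendsto (fun p : E × ℝ => K * ‖p.1‖) (𝓝 0 ×ˢ 𝓝[>] (0 : ℝ)) (𝓝 0) := by
      have hc : Continuous fun u : E => K * ‖u‖ := by fun_prop
      have h1 := hc.tendsto 0
      rw [norm_zero, mul_zero] at h1
      exact h1.comp tendsto_fst
    filter_upwards [h0.eventually (gt_mem_nhds hη), eventually_pos_prod 0,
      eventually_mem_ball hφ.1 0] with p h1 h2 h3
    exact (abs_diffQuot_le hφ h2 h3).trans h1.le
  refine le_antisymm ?_ ?_
  · refine EReal.le_of_forall_lt_iff_le.1 fun r hr => ?_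
    by_contra hlt
    obtain ⟨s, hs1, hs2⟩ := EReal.lt_iff_exists_real_btwn.1 (not_le.1 hlt)
    have hr' : 0 < r := EReal.coe_pos.1 hr
    have hrs : r < s := EReal.coe_lt_coe_iff.1 hs1
    obtain ⟨p, h1, h2⟩ := ((lt_lowerDirDeriv_imp hs2).and (hb r hr')).exists
    linarith [(abs_le.1 h2).2]
  · refine EReal.ge_of_forall_gt_iff_ge.1 fun r hr => ?_
    have hr' : r < 0 := EReal.coe_neg'.1 hr
    refine le_lowerDirDeriv ((hb (-r) (neg_pos.2 hr')).mono fun p hp => ?_)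
    linarith [(abs_le.1 hp).1]

theorem lowerDirDeriv_ne_bot (hφ : LipschitzNear φ x ε K) (v : E) :
    lowerDirDeriv φ x v ≠ ⊥ := by
  have h := lowerDirDeriv_le_add hφ (v := v) (w := 0) (r := -1)
    (by rw [lowerDirDeriv_zero hφ]; exact EReal.coe_neg'.2 (by norm_num))
  exact ne_bot_of_le_ne_bot (EReal.coe_ne_bot _) h

theorem lowerDirDeriv_ne_top (hφ : LipschitzNear φ x ε K) (v : E) :
    lowerDirDeriv φ x v ≠ ⊤ := by
  intro htop
  have h := lowerDirDeriv_le_add hφ (v := 0) (w := v) (r := K * ‖v‖ + 1)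
    (by rw [htop]; exact EReal.coe_lt_top _)
  rw [lowerDirDeriv_zero hφ, sub_zero, add_sub_cancel_left] at h
  exact absurd (EReal.coe_le_coe_iff.1 (h.trans_eq EReal.coe_zero.symm)) (by norm_num)

/-- The lower directional derivative as a real number. -/
noncomputable def realDirDeriv (φ : E → ℝ) (x v : E) : ℝ := (lowerDirDeriv φ x v).toReal

theorem coe_realDirDeriv (hφ : LipschitzNear φ x ε K) (v : E) :
    (realDirDeriv φ x v : EReal) = lowerDirDeriv φ x v :=
  EReal.coe_toReal (lowerDirDeriv_ne_top hφ v) (lowerDirDeriv_ne_bot hφ v)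

theorem isDirectional_realDirDeriv (hφ : LipschitzNear φ x ε K) :
    IsDirectional K (realDirDeriv φ x) where
  lip v w := by
    refine le_of_forall_lt fun r hr => ?_
    obtain ⟨s, hrs, hs⟩ := exists_between hr
    have h := lowerDirDeriv_le_add hφ (v := v) (w := w) (r := s)
      (by rw [← coe_realDirDeriv hφ]; exact EReal.coe_lt_coe_iff.2 hs)
    rw [← coe_realDirDeriv hφ, EReal.coe_le_coe_iff] at h
    linarith
  map_zero := by rw [realDirDeriv, lowerDirDeriv_zero hφ, EReal.toReal_zero]
  nat_mul_le j v := by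
    rcases Nat.eq_zero_or_pos j with rfl | hj
    · simp [realDirDeriv, lowerDirDeriv_zero hφ]
    have hj' : (0 : ℝ) < j := by positivity
    -- The substitution `(u, θ) ↦ (u / j, j θ)` fixes the increment `θ u` and divides the quotient
    -- by `j`.
    have ht : Tendsto (fun p : E × ℝ => ((j : ℝ)⁻¹ • p.1, j * p.2))
        (𝓝 ((j : ℝ) • v) ×ˢ 𝓝[>] (0 : ℝ)) (𝓝 v ×ˢ 𝓝[>] (0 : ℝ)) := by
      refine Tendsto.prodMap ?_ ?_
      · have h1 := (continuous_const_smul ((j : ℝ)⁻¹)).tendsto ((j : ℝ) • v)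
        rwa [inv_smul_smul₀ hj'.ne'] at h1
      · refine tendsto_nhdsWithin_of_tendsto_nhds_of_eventually_within _ ?_ ?_
        · have h1 := (continuous_const_mul (j : ℝ)).tendsto 0
          rw [mul_zero] at h1
          exact h1.mono_left nhdsWithin_le_nhds
        · filter_upwards [self_mem_nhdsWithin] with θ hθ
          exact mul_pos hj' hθ
    refine le_of_forall_lt fun r hr => ?_
    obtain ⟨s, hrs, hs⟩ := exists_between hr
    have hs' : ((s / j : ℝ) : EReal) < lowerDirDeriv φ x v := by
      rw [← coe_realDirDeriv hφ, EReal.coe_lt_coe_iff, div_lt_iff₀ hj']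
      linarith
    have h : (s : EReal) ≤ lowerDirDeriv φ x ((j : ℝ) • v) := by
      apply le_lowerDirDeriv
      filter_upwards [ht.eventually (lt_lowerDirDeriv_imp hs'), eventually_pos_prod _]
        with p h1 h2
      have h3 : diffQuot φ x ((j : ℝ)⁻¹ • p.1, j * p.2) = diffQuot φ x p / j := by
        unfold diffQuot
        dsimp only
        rw [smul_smul, mul_right_comm, mul_inv_cancel₀ hj'.ne', one_mul, div_div, mul_comm p.2]
      rw [h3, div_lt_div_iff_of_pos_right hj'] at h1
      exact h1.le
    rw [← coe_realDirDeriv hφ, EReal.coe_le_coe_iff] at h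
    linarith

theorem mem_gateauxSubdiff_iff (hφ : LipschitzNear φ x ε K) (ξ : WeakDual ℝ E) :
    ξ ∈ gateauxSubdiff φ x ↔ ∀ v, ξ v ≤ realDirDeriv φ x v := by
  refine forall_congr' fun v => ?_
  rw [← coe_realDirDeriv hφ, EReal.coe_le_coe_iff]

/-- The lower limit may be computed along a dense sequence. -/
theorem lowerDirDeriv_eq_liminf_comap (hφ : LipschitzNear φ x ε K) {c : ℕ → E × ℝ}
    (hc : DenseRange c) (v : E) :
    lowerDirDeriv φ x v = liminf (fun i => (diffQuot φ x (c i) : EReal))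
      (comap c (𝓝 v ×ˢ 𝓝[>] (0 : ℝ))) := by
  rw [lowerDirDeriv_eq]
  refine le_antisymm ?_ ?_
  · have h1 : liminf (fun i => (diffQuot φ x (c i) : EReal)) (comap c (𝓝 v ×ˢ 𝓝[>] (0 : ℝ)))
        = liminf (fun p => (diffQuot φ x p : EReal)) (map c (comap c (𝓝 v ×ˢ 𝓝[>] (0 : ℝ)))) :=
      rfl
    rw [h1]
    exact liminf_le_liminf_of_le map_comap_le
  · refine EReal.ge_of_forall_gt_iff_ge.1 fun r hr => ?_
    have hev : ∀ᶠ p in 𝓝 v ×ˢ 𝓝[>] (0 : ℝ), p ∈ Set.range c → r < diffQuot φ x p := by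
      have h := eventually_lt_of_lt_liminf hr
      rw [eventually_comap] at h
      filter_upwards [h] with p hp
      rintro ⟨i, rfl⟩
      exact EReal.coe_lt_coe_iff.1 (hp i rfl)
    have hgood := (hev.and (eventually_mem_ball (x := x) hφ.1 v)).and (eventually_pos_prod v)
    obtain ⟨⟨U, δ⟩, ⟨⟨hvU, hU⟩, hδ⟩, hsub⟩ :=
      ((nhds_basis_opens v).prod (nhdsGT_basis (0 : ℝ))).eventually_iff.1 hgood
    refine le_lowerDirDeriv ?_
    refine ((nhds_basis_opens v).prod (nhdsGT_basis (0 : ℝ))).eventually_iff.2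
      ⟨⟨U, δ⟩, ⟨⟨hvU, hU⟩, hδ⟩, fun p hp => ?_⟩
    dsimp only at hp hsub
    have hopen : IsOpen (U ×ˢ Set.Ioo (0 : ℝ) δ) := hU.prod isOpen_Ioo
    -- On this open box the quotient is continuous, so a value below `r` at `p` would persist at
    -- some point of the dense sequence in the box.
    have hcont : ContinuousAt (diffQuot φ x) p := by
      obtain ⟨⟨-, hball⟩, hpos⟩ := hsub hp
      have hφc : ContinuousAt φ (x + p.2 • p.1) := by
        have hl : LipschitzOnWith (Real.toNNReal K) φ (Metric.ball x ε) :=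
          LipschitzOnWith.of_dist_le' fun y hy z hz => by
            rw [Real.dist_eq, dist_eq_norm]; exact hφ.2 y hy z hz
        exact hl.continuousOn.continuousAt (Metric.isOpen_ball.mem_nhds hball)
      have h1 : ContinuousAt (fun p : E × ℝ => x + p.2 • p.1) p := by fun_prop
      have h2 : ContinuousAt (fun p : E × ℝ => φ (x + p.2 • p.1)) p :=
        ContinuousAt.comp (f := fun p : E × ℝ => x + p.2 • p.1) hφc h1
      exact (h2.sub continuousAt_const).div continuousAt_snd hpos.ne'
    by_contra hlt
    have hlt' := not_le.1 hlt
    have hnear := (hcont.eventually (gt_mem_nhds hlt')).and (hopen.mem_nhds hp)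
    obtain ⟨q, hq3, hq1, hq2⟩ := Dense.inter_nhds_nonempty hc hnear
    exact absurd ((hsub hq2).1.1 hq3) (not_lt.2 hq1.le)

/-- Measurability of the lower directional derivative of a family of functions. -/
theorem measurable_realDirDeriv [TopologicalSpace.SeparableSpace E] {T : Type*}
    [MeasurableSpace T] {L : T → E → ℝ} {x : T → E} {ε : ℝ} {K : T → ℝ}
    (hφ : ∀ t, LipschitzNear (L t) (x t) ε (K t))
    (hL : ∀ (θ : ℝ) (u : E), Measurable fun t => L t (x t + θ • u)) (v : E) :
    Measurable fun t => realDirDeriv (L t) (x t) v := by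
  have hc : DenseRange (TopologicalSpace.denseSeq (E × ℝ)) :=
    TopologicalSpace.denseRange_denseSeq _
  have hL0 : Measurable fun t => L t (x t) := by simpa using hL 0 0
  simp only [realDirDeriv, lowerDirDeriv_eq_liminf_comap (hφ _) hc]
  refine measurable_ereal_toReal.comp ?_
  -- The pulled-back filter on `ℕ` has a countable basis, so its lower limit is built from countable
  -- suprema and infima.
  obtain ⟨b, hb⟩ := (comap (TopologicalSpace.denseSeq (E × ℝ))
    (𝓝 v ×ˢ 𝓝[>] (0 : ℝ))).exists_antitone_basis
  refine Measurable.liminf' (fun i => ?_) ⟨hb.1, Set.to_countable _⟩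
    fun j => Set.to_countable _
  exact (((hL _ _).sub hL0).div_const _).coe_real_ereal

end Dini

end GateauxGelfand

namespace GateauxGelfand

/-! ### Weak limits of dominated scalar functions. -/

section WeakLimits

/-- Bounded families in a Hilbert space have weak limits along ultrafilters. -/
theorem exists_weak_limit {H : Type*} [NormedAddCommGroup H] [InnerProductSpace ℝ H]
    [CompleteSpace H] {α : Type*} (U : Ultrafilter α) {a : α → H} {C : ℝ}
    (ha : ∀ i, ‖a i‖ ≤ C) :
    ∃ h : H, ∀ g : H, Tendsto (fun i => inner ℝ (a i) g) U (𝓝 (inner ℝ h g)) := by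
  let b : α → WeakDual ℝ H := fun i =>
    StrongDual.toWeakDual (InnerProductSpace.toDual ℝ H (a i))
  have hK := WeakDual.isCompact_closedBall (0 : StrongDual ℝ H) C
  have hmem : ((U.map b : Ultrafilter (WeakDual ℝ H)) : Filter (WeakDual ℝ H)) ≤
      𝓟 (WeakDual.toStrongDual ⁻¹' Metric.closedBall (0 : StrongDual ℝ H) C) := by
    rw [le_principal_iff]
    refine Filter.univ_mem' (f := (U : Filter α)) fun i => ?_
    change InnerProductSpace.toDual ℝ H (a i) ∈ Metric.closedBall (0 : StrongDual ℝ H) C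
    rw [mem_closedBall_zero_iff, LinearIsometryEquiv.norm_map]
    exact ha i
  obtain ⟨ℓ, -, hℓ⟩ := isCompact_iff_ultrafilter_le_nhds.1 hK _ hmem
  refine ⟨(InnerProductSpace.toDual ℝ H).symm (WeakDual.toStrongDual ℓ), fun g => ?_⟩
  have h1 : Tendsto (fun η : WeakDual ℝ H => η g) (𝓝 ℓ) (𝓝 (ℓ g)) :=
    (WeakDual.eval_continuous g).tendsto ℓ
  have h2 : Tendsto (fun i => b i g) U (𝓝 (ℓ g)) := h1.comp hℓ
  rw [InnerProductSpace.toDual_symm_apply]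
  exact h2

variable {T : Type*} [MeasurableSpace T] {μ : Measure T}

/-- A family of functions dominated by an integrable function has, along an ultrafilter,
a limit in the sense of convergence of the integrals over measurable sets. -/
theorem exists_setIntegral_limit {α : Type*} (U : Ultrafilter α) {K : T → ℝ}
    (hK : Integrable K μ) (hK0 : ∀ t, 0 ≤ K t) {a : α → T → ℝ}
    (ham : ∀ i, AEStronglyMeasurable (a i) μ) {C : ℝ}
    (ha : ∀ i, ∀ᵐ t ∂μ, |a i t| ≤ C * K t) :
    ∃ F : T → ℝ, Integrable F μ ∧ ∀ A : Set T, MeasurableSet A →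
      Tendsto (fun i => ∫ t in A, a i t ∂μ) U (𝓝 (∫ t in A, F t ∂μ)) := by
  -- Division by `√K` turns domination by `C K` into domination by `C √K`, hence a bound in `L²`.
  -- Testing a weak limit `h` against `√K` restricted to `A` recovers the integral over `A`, with `F
  -- = h √K`.
  set s : T → ℝ := fun t => √(K t) with hs
  have hsm : AEStronglyMeasurable s μ :=
    (Real.continuous_sqrt.comp_aestronglyMeasurable hK.aestronglyMeasurable)
  have hss : ∀ t, s t * s t = K t := fun t => Real.mul_self_sqrt (hK0 t)
  have hsL : MemLp s 2 μ := by
    rw [memLp_two_iff_integrable_sq hsm]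
    simpa only [sq, hss] using hK
  have hbm : ∀ i, AEStronglyMeasurable (fun t => a i t / s t) μ := fun i =>
    ((ham i).aemeasurable.div hsm.aemeasurable).aestronglyMeasurable
  have hbb : ∀ i, ∀ᵐ t ∂μ, ‖a i t / s t‖ ≤ ‖C * s t‖ := by
    intro i
    filter_upwards [ha i] with t ht
    rcases (Real.sqrt_nonneg (K t)).eq_or_lt with h0 | h0
    · have : s t = 0 := h0.symm
      simp [this]
    · have h0' : 0 < s t := h0
      refine le_trans ?_ (le_abs_self _)
      rw [Real.norm_eq_abs, abs_div, abs_of_pos h0', div_le_iff₀ h0', mul_assoc, hss]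
      exact ht
  have hbL : ∀ i, MemLp (fun t => a i t / s t) 2 μ := fun i =>
    (hsL.const_mul C).mono (hbm i) (hbb i)
  -- Where `K` vanishes so does `a i`, and division by zero loses nothing.
  have hmul : ∀ i, ∀ᵐ t ∂μ, a i t / s t * s t = a i t := by
    intro i
    filter_upwards [ha i] with t ht
    refine div_mul_cancel_of_imp fun h0 => ?_
    have h1 := hss t
    rw [h0, mul_zero] at h1
    rw [← h1, mul_zero] at ht
    exact abs_nonpos_iff.1 ht
  obtain ⟨h, hh⟩ := exists_weak_limit U (a := fun i => (hbL i).toLp)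
    (C := ‖(hsL.const_mul C).toLp‖) (fun i => by
      refine Lp.norm_le_norm_of_ae_le ?_
      filter_upwards [(hbL i).coeFn_toLp, (hsL.const_mul C).coeFn_toLp, hbb i] with t h1 h2 h3
      rw [h1, h2]; exact h3)
  refine ⟨fun t => h t * s t, (Lp.memLp h).integrable_mul hsL, fun A hA => ?_⟩
  have hsA : MemLp (A.indicator s) 2 μ := hsL.indicator hA
  have key : ∀ (f : Lp ℝ 2 μ), inner ℝ f hsA.toLp = ∫ t in A, f t * s t ∂μ := by
    intro f
    rw [L2.inner_def, ← integral_indicator hA]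
    refine integral_congr_ae ?_
    filter_upwards [hsA.coeFn_toLp] with t ht
    rw [ht]
    by_cases htA : t ∈ A <;> simp [htA, mul_comm]
  have h1 := hh hsA.toLp
  rw [key] at h1
  refine h1.congr fun i => ?_
  rw [key]
  refine integral_congr_ae (ae_restrict_of_ae ?_)
  filter_upwards [(hbL i).coeFn_toLp, hmul i] with t h1 h2
  rw [h1, h2]

end WeakLimits

/-! ### Gelfand integrals of the minorants of an integrable sublinear family. -/

section Family

variable {E : Type*} [NormedAddCommGroup E] [NormedSpace ℝ E]
  {T : Type*} [MeasurableSpace T] {μ : Measure T}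

/-- An almost everywhere sublinear family of functions, dominated by an integrable multiple of
the norm and measurable in the parameter. -/
structure IsIntegrableSublinear (μ : Measure T) (K : T → ℝ) (p : T → E → ℝ) : Prop where
  nonneg : ∀ t, 0 ≤ K t
  integrable_bound : Integrable K μ
  measurable : ∀ v, NullMeasurable (fun t => p t v) μ
  sublinear : ∀ᵐ t ∂μ, IsSublinear (K t) (p t)

/-- The multifunction of the linear functionals dominated by `p t`. -/
def minorants (p : T → E → ℝ) (t : T) : Set (WeakDual ℝ E) := {ξ | ∀ v, ξ v ≤ p t v}

variable {K : T → ℝ} {p : T → E → ℝ}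

theorem abs_le_of_mem_minorants {k : ℝ} {q : E → ℝ} (hq : IsSublinear k q) {ξ : WeakDual ℝ E}
    (hξ : ∀ v, ξ v ≤ q v) (v : E) : |ξ v| ≤ ‖v‖ * k := by
  have h1 := (hξ v).trans (hq.le_norm v)
  have h2 := (hξ (-v)).trans (hq.le_norm (-v))
  rw [map_neg, norm_neg] at h2
  exact abs_le.2 ⟨by linarith, by linarith⟩

theorem IsIntegrableSublinear.integrable (hp : IsIntegrableSublinear μ K p) (v : E) :
    Integrable (fun t => p t v) μ := by
  refine (hp.integrable_bound.const_mul ‖v‖).mono'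
    (hp.measurable v).aemeasurable.aestronglyMeasurable ?_
  filter_upwards [hp.sublinear] with t ht
  exact abs_le.2 ⟨by linarith [ht.neg_norm_le v], by linarith [ht.le_norm v]⟩

/-- A weak* measurable selector of the minorants has a Gelfand integral. -/
theorem IsIntegrableSublinear.mem_gelfandSelectors (hp : IsIntegrableSublinear μ K p)
    {f : T → WeakDual ℝ E} (hf : WeakStarScalarlyMeasurable μ f)
    (hfp : ∀ᵐ t ∂μ, f t ∈ minorants p t) : f ∈ gelfandSelectors μ (minorants p) := by
  have hb : ∀ v, ∀ᵐ t ∂μ, ‖f t v‖ ≤ ‖v‖ * K t := by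
    intro v
    filter_upwards [hp.sublinear, hfp] with t h1 h2
    exact abs_le_of_mem_minorants h1 h2 v
  have hi : ∀ v, Integrable (fun t => f t v) μ := fun v =>
    (hp.integrable_bound.const_mul ‖v‖).mono' (hf v).aemeasurable.aestronglyMeasurable (hb v)
  let ℓ : E →ₗ[ℝ] ℝ :=
    { toFun := fun v => ∫ t, f t v ∂μ
      map_add' := fun v w => by simp only [map_add]; exact integral_add (hi v) (hi w)
      map_smul' := fun c v => by
        simp only [map_smul, smul_eq_mul, RingHom.id_apply]; exact integral_const_mul c _ }
  have hℓ : ∀ v, ‖ℓ v‖ ≤ (∫ t, K t ∂μ) * ‖v‖ := by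
    intro v
    refine (norm_integral_le_of_norm_le (hp.integrable_bound.const_mul ‖v‖) (hb v)).trans_eq ?_
    rw [integral_const_mul, mul_comm]
  exact ⟨hfp, StrongDual.toWeakDual (ℓ.mkContinuous _ hℓ), hf, fun v => ⟨hi v, rfl⟩⟩

theorem convex_gelfandIntegral_minorants (μ : Measure T) (p : T → E → ℝ) :
    Convex ℝ (gelfandIntegral μ (minorants p)) := by
  rintro ξ ⟨f, hf, hfm, hfi⟩ η ⟨g, hg, hgm, hgi⟩ a b ha hb hab
  have h : HasGelfandIntegral μ (fun t => a • f t + b • g t) (a • ξ + b • η) := by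
    refine ⟨fun v => ?_, fun v => ⟨?_, ?_⟩⟩
    · exact Measurable.add (α := NullMeasurableSpace T μ)
        (Measurable.const_mul (α := NullMeasurableSpace T μ) (hfm v) a)
        (Measurable.const_mul (α := NullMeasurableSpace T μ) (hgm v) b)
    · exact ((hfi v).1.const_mul a).add ((hgi v).1.const_mul b)
    · change a * ξ v + b * η v = ∫ t, (a * f t v + b * g t v) ∂μ
      rw [integral_add ((hfi v).1.const_mul a) ((hgi v).1.const_mul b), integral_const_mul,
        integral_const_mul, (hfi v).2, (hgi v).2]
  refine ⟨_, ⟨?_, _, h⟩, h⟩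
  filter_upwards [hf.1, hg.1] with t h1 h2 v
  change a * f t v + b * g t v ≤ p t v
  have h3 := mul_le_mul_of_nonneg_left (h1 v) ha
  have h4 := mul_le_mul_of_nonneg_left (h2 v) hb
  have h5 : a * p t v + b * p t v = p t v := by rw [← add_mul, hab, one_mul]
  linarith

/-- An additive function on a dense subgroup, dominated by a sublinear function, extends
to a dominated continuous linear functional. -/
theorem exists_weakDual_extension {k : ℝ} {q : E → ℝ} (hq : IsSublinear k q)
    {D : AddSubgroup E} (hD : Dense (D : Set E)) {F : D → ℝ}
    (hadd : ∀ d d' : D, F (d + d') = F d + F d') (hle : ∀ d : D, F d ≤ q d) :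
    ∃ ξ : WeakDual ℝ E, (∀ w, ξ w = ⨅ d : D, (F d + q (w - d))) ∧ (∀ w, ξ w ≤ q w) ∧
      ∀ d : D, ξ d = F d := by
  have h0 : F 0 = 0 := by have := hadd 0 0; rw [add_zero] at this; linarith
  have hneg : ∀ d, F (-d) = -F d := fun d => by
    have := hadd d (-d); rw [add_neg_cancel, h0] at this; linarith
  have hlow : ∀ (w : E) (d : D), -q (-w) ≤ F d + q (w - d) := by
    intro w d
    have h1 := hle (-d)
    have h2 := hq.add_le (w - d) (-w)
    rw [hneg] at h1
    rw [show w - (d : E) + -w = ((-d : D) : E) by push_cast; abel] at h2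
    linarith
  have hinf : ∀ (w : E) (d : D), ⨅ d : D, (F d + q (w - d)) ≤ F d + q (w - d) := fun w d =>
    ciInf_le ⟨-q (-w), by rintro _ ⟨d, rfl⟩; exact hlow w d⟩ d
  have hqle : ∀ w : E, ⨅ d : D, (F d + q (w - d)) ≤ q w := fun w => by
    simpa [h0] using hinf w 0
  have hFle : ∀ d' : D, ⨅ d : D, (F d + q ((d' : E) - d)) ≤ F d' := fun d' => by
    simpa [hq.map_zero] using hinf d' d'
  -- The Hahn–Banach majorant is at most `F d` at `d` and at most `-F d` at `-d`; being odd on the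
  -- dense `D`, it is itself linear. For countable `D` this formula also gives measurability in a
  -- parameter.
  obtain ⟨ξ, hξ⟩ := exists_weakDual_eq_of_subadditive (K := k)
    (G := fun w => ⨅ d : D, (F d + q (w - d))) hD
    (fun v w => by
      refine le_ciInf_add_ciInf fun d d' => (hinf (v + w) (d + d')).trans ?_
      have h := hq.add_le (v - d) (w - d')
      rw [show v - (d : E) + (w - d') = v + w - ((d + d' : D) : E) by push_cast; abel] at h
      rw [hadd]
      linarith)
    (fun w => (hqle w).trans (hq.le_norm w))
    (fun d hd => by
      have h1 := hFle ⟨d, hd⟩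
      have h2 := hFle (-⟨d, hd⟩)
      rw [hneg] at h2
      push_cast at h2
      linarith)
  have hξF : ∀ d : D, ξ d ≤ F d := fun d => (hξ d).trans_le (hFle d)
  refine ⟨ξ, hξ, fun w => (hξ w).trans_le (hqle w), fun d => le_antisymm (hξF d) ?_⟩
  have h := hξF (-d)
  rw [hneg] at h
  push_cast at h
  rw [map_neg] at h
  linarith

theorem IsIntegrableSublinear.le_integral (hp : IsIntegrableSublinear μ K p)
    {ξ : WeakDual ℝ E} (hξ : ξ ∈ gelfandIntegral μ (minorants p)) (v : E) :
    ξ v ≤ ∫ t, p t v ∂μ := by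
  obtain ⟨f, hf, -, hfv⟩ := hξ
  rw [(hfv v).2]
  refine integral_mono_ae (hfv v).1 (hp.integrable v) ?_
  filter_upwards [hf.1] with t ht
  exact ht v

variable [TopologicalSpace.SeparableSpace E]

/-- There is a measurable selector attaining the supremum in a given direction. -/
theorem IsIntegrableSublinear.exists_selector (hp : IsIntegrableSublinear μ K p) (v : E) :
    ∃ f ∈ gelfandSelectors μ (minorants p), ∀ᵐ t ∂μ, f t v = p t v := by
  classical
  -- Putting `v` first makes the first face the one where `v` is maximised.
  let e : ℕ → E := fun n => Nat.casesOn n v (TopologicalSpace.denseSeq E)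
  have he : DenseRange e := by
    refine (TopologicalSpace.denseRange_denseSeq E).mono ?_
    rintro _ ⟨n, rfl⟩
    exact ⟨n + 1, rfl⟩
  have hex : ∀ t, ∃ ξ : WeakDual ℝ E, IsSublinear (K t) (p t) →
      (∀ w, ξ w = ⨅ n, faceSeq (p t) e n w) ∧ (∀ w, ξ w ≤ p t w) ∧ ξ v = p t v := by
    intro t
    by_cases ht : IsSublinear (K t) (p t)
    · obtain ⟨ξ, hξ⟩ := exists_weakDual_eq_ciInf_faceSeq ht he
      exact ⟨ξ, fun _ => hξ⟩
    · exact ⟨0, fun h => absurd h ht⟩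
  choose f hf using hex
  refine ⟨f, hp.mem_gelfandSelectors (fun w => ?_) ?_, ?_⟩
  · have hm : NullMeasurable (fun t => ⨅ n, faceSeq (p t) e n w) μ :=
      Measurable.iInf (δ := NullMeasurableSpace T μ) fun n =>
        measurable_faceSeq (T := NullMeasurableSpace T μ) hp.measurable e n w
    refine hm.congr ?_
    filter_upwards [hp.sublinear] with t ht
    exact ((hf t ht).1 w).symm
  · filter_upwards [hp.sublinear] with t ht
    exact (hf t ht).2.1
  · filter_upwards [hp.sublinear] with t ht
    exact (hf t ht).2.2

theorem IsIntegrableSublinear.supportFn_eq (hp : IsIntegrableSublinear μ K p) (v : E) :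
    ∀ᵐ t ∂μ, supportFn v (minorants p t) = (p t v : EReal) := by
  obtain ⟨f, hf, hfv⟩ := hp.exists_selector v
  filter_upwards [hf.1, hfv] with t h1 h2
  refine le_antisymm (iSup₂_le fun ξ hξ => EReal.coe_le_coe_iff.2 (hξ v)) ?_
  rw [← h2]
  exact le_iSup₂ (f := fun (ξ : WeakDual ℝ E) (_ : ξ ∈ minorants p t) => ((ξ v : ℝ) : EReal))
    (f t) h1

theorem IsIntegrableSublinear.integral_supportFn (hp : IsIntegrableSublinear μ K p) (v : E) :
    ∫ t, (supportFn v (minorants p t)).toReal ∂μ = ∫ t, p t v ∂μ := by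
  refine integral_congr_ae ?_
  filter_upwards [hp.supportFn_eq v] with t ht
  rw [ht, EReal.toReal_coe]

theorem IsIntegrableSublinear.gelfandIntegrable (hp : IsIntegrableSublinear μ K p) :
    GelfandIntegrable μ (minorants p) where
  nonempty_selectors := (hp.exists_selector 0).imp fun _ h => h.1
  support_finite v := by
    filter_upwards [hp.supportFn_eq v] with t ht
    rw [ht]
    exact ⟨EReal.coe_ne_bot _, EReal.coe_ne_top _⟩
  support_integrable v := by
    refine (hp.integrable v).congr ?_
    filter_upwards [hp.supportFn_eq v] with t ht
    rw [ht, EReal.toReal_coe]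

/-- The upper bound is integrated pointwise domination; a selector maximal in direction `v` attains
it. -/
theorem IsIntegrableSublinear.supportFn_gelfandIntegral (hp : IsIntegrableSublinear μ K p)
    (v : E) : supportFn v (gelfandIntegral μ (minorants p)) = ((∫ t, p t v ∂μ : ℝ) : EReal) := by
  refine le_antisymm (iSup₂_le fun ξ hξ => EReal.coe_le_coe_iff.2 (hp.le_integral hξ v)) ?_
  obtain ⟨f, hf, hfv⟩ := hp.exists_selector v
  obtain ⟨ξ, hξ⟩ := hf.2
  rw [← integral_congr_ae hfv, ← (hξ.2 v).2]
  exact le_iSup₂ (f := fun (ξ : WeakDual ℝ E) (_ : ξ ∈ gelfandIntegral μ (minorants p)) =>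
    ((ξ v : ℝ) : EReal)) ξ ⟨f, hf, hξ⟩

theorem IsIntegrableSublinear.isCompact_gelfandIntegral (hp : IsIntegrableSublinear μ K p) :
    IsCompact (gelfandIntegral μ (minorants p)) := by
  classical
  rw [isCompact_iff_ultrafilter_le_nhds]
  intro U hU
  set Γ := gelfandIntegral μ (minorants p) with hΓ
  have hball : Γ ⊆ WeakDual.toStrongDual ⁻¹'
      Metric.closedBall (0 : StrongDual ℝ E) (∫ t, K t ∂μ) := by
    intro ξ hξ
    change WeakDual.toStrongDual ξ ∈ Metric.closedBall (0 : StrongDual ℝ E) (∫ t, K t ∂μ)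
    rw [mem_closedBall_zero_iff]
    refine ContinuousLinearMap.opNorm_le_bound _ (integral_nonneg hp.nonneg) fun v => ?_
    change |ξ v| ≤ _
    have hb : ∀ v : E, ξ v ≤ (∫ t, K t ∂μ) * ‖v‖ := by
      intro v
      refine (hp.le_integral hξ v).trans ?_
      rw [← integral_mul_const]
      refine integral_mono_ae (hp.integrable v) (hp.integrable_bound.mul_const _) ?_
      filter_upwards [hp.sublinear] with t ht
      exact ht.le_norm v
    have h2 := hb (-v)
    rw [map_neg, norm_neg] at h2
    exact abs_le.2 ⟨by linarith, hb v⟩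
  -- Banach–Alaoglu supplies the limit; what remains is that it is the integral of a selector.
  obtain ⟨ξ₁, -, hξ₁⟩ := isCompact_iff_ultrafilter_le_nhds.1
    (WeakDual.isCompact_closedBall (0 : StrongDual ℝ E) (∫ t, K t ∂μ)) U
    (hU.trans (principal_mono.2 hball))
  refine ⟨ξ₁, ?_, hξ₁⟩
  have hlim : ∀ v, Tendsto (fun ξ : WeakDual ℝ E => ξ v) U (𝓝 (ξ₁ v)) := fun v =>
    ((WeakDual.eval_continuous v).tendsto ξ₁).mono_left hξ₁
  obtain ⟨f₀, hf₀, -⟩ := hp.exists_selector 0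
  -- Outside `Γ` the fixed selector `f₀` is used, so that the domination holds for every index.
  have hex : ∀ ξ : WeakDual ℝ E, ∃ f ∈ gelfandSelectors μ (minorants p),
      ξ ∈ Γ → HasGelfandIntegral μ f ξ := by
    intro ξ
    by_cases hξ : ξ ∈ Γ
    · obtain ⟨f, hf, hfi⟩ := hξ
      exact ⟨f, hf, fun _ => hfi⟩
    · exact ⟨f₀, hf₀, fun h => absurd h hξ⟩
  choose f hf hfi using hex
  have hint : ∀ ξ v, Integrable (fun t => f ξ t v) μ := by
    intro ξ v
    obtain ⟨η, hη⟩ := (hf ξ).2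
    exact (hη.2 v).1
  have hF : ∀ v : E, ∃ F : T → ℝ, Integrable F μ ∧ ∀ A : Set T, MeasurableSet A →
      Tendsto (fun ξ => ∫ t in A, f ξ t v ∂μ) U (𝓝 (∫ t in A, F t ∂μ)) := by
    intro v
    refine exists_setIntegral_limit U hp.integrable_bound hp.nonneg (C := ‖v‖)
      (fun ξ => (hint ξ v).aestronglyMeasurable) fun ξ => ?_
    filter_upwards [hp.sublinear, (hf ξ).1] with t h1 h2
    exact abs_le_of_mem_minorants h1 h2 v
  choose F hFi hFl using hF
  have hFadd : ∀ v w, F (v + w) =ᵐ[μ] fun t => F v t + F w t := by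
    intro v w
    refine Integrable.ae_eq_of_forall_setIntegral_eq _ _ (hFi _) ((hFi v).add (hFi w))
      fun A hA _ => ?_
    rw [integral_add (hFi v).integrableOn (hFi w).integrableOn]
    refine tendsto_nhds_unique (hFl (v + w) A hA) ?_
    refine ((hFl v A hA).add (hFl w A hA)).congr fun ξ => ?_
    simp only [map_add]
    exact (integral_add (hint ξ v).integrableOn (hint ξ w).integrableOn).symm
  have hFle : ∀ v, F v ≤ᵐ[μ] fun t => p t v := by
    intro v
    refine ae_le_of_forall_setIntegral_le (hFi v) (hp.integrable v) fun A hA _ => ?_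
    refine le_of_tendsto (hFl v A hA) (Eventually.of_forall fun ξ => ?_)
    refine integral_mono_ae (hint ξ v).integrableOn (hp.integrable v).integrableOn
      (ae_restrict_of_ae ?_)
    filter_upwards [(hf ξ).1] with t ht
    exact ht v
  have hFint : ∀ v, ∫ t, F v t ∂μ = ξ₁ v := by
    intro v
    have h1 := hFl v Set.univ MeasurableSet.univ
    simp only [setIntegral_univ] at h1
    refine tendsto_nhds_unique h1 ((hlim v).congr' ?_)
    filter_upwards [hU (mem_principal_self Γ)] with ξ hξ
    exact ((hfi ξ hξ).2 v).2
  -- Additivity and domination of `F` hold off null sets depending on the vectors. Integer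
  -- combinations of a dense sequence form a countable dense subgroup, so one null set serves for
  -- all of it.
  set D : AddSubgroup E :=
    (Finsupp.linearCombination ℤ (TopologicalSpace.denseSeq E)).toAddMonoidHom.range with hDdef
  have hD : Dense (D : Set E) := by
    refine (TopologicalSpace.denseRange_denseSeq E).mono ?_
    rintro _ ⟨n, rfl⟩
    exact ⟨Finsupp.single n 1, by simp⟩
  have hDc : Countable D := (Set.countable_range
    (Finsupp.linearCombination ℤ (TopologicalSpace.denseSeq E))).to_subtype
  have hgood : ∀ᵐ t ∂μ, IsSublinear (K t) (p t) ∧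
      (∀ d d' : D, F (d + d' : D) t = F d t + F d' t) ∧ ∀ d : D, F d t ≤ p t d := by
    filter_upwards [hp.sublinear, ae_all_iff.2 fun d : D => ae_all_iff.2 fun d' : D =>
      hFadd d d', ae_all_iff.2 fun d : D => hFle d] with t h1 h2 h3
    exact ⟨h1, fun d d' => by rw [AddSubgroup.coe_add]; exact h2 d d', h3⟩
  have hexη : ∀ t, ∃ η : WeakDual ℝ E, (IsSublinear (K t) (p t) ∧
      (∀ d d' : D, F (d + d' : D) t = F d t + F d' t) ∧ ∀ d : D, F d t ≤ p t d) →
      (∀ w, η w = ⨅ d : D, (F d t + p t (w - d))) ∧ (∀ w, η w ≤ p t w) ∧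
      ∀ d : D, η d = F d t := by
    intro t
    by_cases ht : IsSublinear (K t) (p t) ∧
      (∀ d d' : D, F (d + d' : D) t = F d t + F d' t) ∧ ∀ d : D, F d t ≤ p t d
    · obtain ⟨η, hη⟩ := exists_weakDual_extension ht.1 hD (F := fun d : D => F d t) ht.2.1 ht.2.2
      exact ⟨η, fun _ => hη⟩
    · exact ⟨0, fun h => absurd h ht⟩
  choose η hη using hexη
  have hηsel : η ∈ gelfandSelectors μ (minorants p) := by
    refine hp.mem_gelfandSelectors (fun w => ?_) ?_
    · have hm : AEMeasurable (fun t => ⨅ d : D, (F d t + p t (w - d))) μ :=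
        AEMeasurable.iInf fun d =>
          (hFi d).aestronglyMeasurable.aemeasurable.add (hp.measurable _).aemeasurable
      refine hm.nullMeasurable.congr ?_
      filter_upwards [hgood] with t ht
      exact ((hη t ht).1 w).symm
    · filter_upwards [hgood] with t ht
      exact (hη t ht).2.1
  obtain ⟨ξ₀, hξ₀⟩ := hηsel.2
  -- The constructed selector agrees with `F` on `D`, whose integrals are the values of the limit;
  -- density then identifies the two functionals.
  have heq : ∀ d ∈ D, ξ₀ d = ξ₁ d := by
    intro d hd
    rw [(hξ₀.2 d).2, ← hFint d]
    refine integral_congr_ae ?_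
    filter_upwards [hgood] with t ht
    exact (hη t ht).2.2 ⟨d, hd⟩
  have hξ : ξ₀ = ξ₁ := by
    refine DFunLike.coe_injective (Continuous.ext_on hD ?_ ?_ heq)
    · exact (WeakDual.toStrongDual ξ₀).continuous
    · exact (WeakDual.toStrongDual ξ₁).continuous
  exact ⟨η, hηsel, hξ ▸ hξ₀⟩

end Family

end GateauxGelfand

namespace GateauxGelfand

/-! ### Passage from the subdifferentials to the sublinear family. -/

section Congr

variable {E : Type*} [NormedAddCommGroup E] [NormedSpace ℝ E] {T : Type*} [MeasurableSpace T]
  {μ : Measure T} {Φ Ψ : T → Set (WeakDual ℝ E)}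

theorem gelfandSelectors_congr (h : ∀ᵐ t ∂μ, Φ t = Ψ t) :
    gelfandSelectors μ Φ = gelfandSelectors μ Ψ := by
  ext f
  refine and_congr_left fun _ => eventually_congr ?_
  filter_upwards [h] with t ht
  rw [ht]

theorem gelfandIntegral_congr (h : ∀ᵐ t ∂μ, Φ t = Ψ t) :
    gelfandIntegral μ Φ = gelfandIntegral μ Ψ := by
  unfold gelfandIntegral
  rw [gelfandSelectors_congr h]

theorem GelfandIntegrable.congr (hΨ : GelfandIntegrable μ Ψ) (h : ∀ᵐ t ∂μ, Φ t = Ψ t) :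
    GelfandIntegrable μ Φ where
  nonempty_selectors := by
    rw [gelfandSelectors_congr h]
    exact hΨ.nonempty_selectors
  support_finite v := by
    filter_upwards [h, hΨ.support_finite v] with t h1 h2
    rwa [h1]
  support_integrable v := by
    refine (hΨ.support_integrable v).congr ?_
    filter_upwards [h] with t ht
    rw [ht]

end Congr

section Subdifferential

variable {E : Type*} [NormedAddCommGroup E] [NormedSpace ℝ E]
  [TopologicalSpace.SeparableSpace E]

/-- A linear functional below `q` survives each infimal convolution, hence lies below the hull. The
given `ξ` bounds the infima from below, so the hull does lie under `q`. -/
theorem gateauxSubdiff_eq_minorants {φ : E → ℝ} {x : E} {ε K : ℝ} (hφ : LipschitzNear φ x ε K)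
    {ξ : WeakDual ℝ E} (hξ : ξ ∈ gateauxSubdiff φ x) :
    gateauxSubdiff φ x = {η | ∀ v, η v ≤ sublinearHull (realDirDeriv φ x) v} := by
  have hξ' := (mem_gateauxSubdiff_iff hφ ξ).1 hξ
  ext η
  rw [mem_gateauxSubdiff_iff hφ]
  exact ⟨fun h v => le_sublinearHull h v, fun h v => (h v).trans (sublinearHull_le hξ' v)⟩

/-- The sublinear hulls of the lower directional derivatives of a normal integrand which is
Lipschitz near `x t` with integrable constant form an integrable sublinear family. -/
theorem isIntegrableSublinear_hull [MeasurableSpace E] [BorelSpace E] {T : Type*}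
    [MeasurableSpace T] {μ : Measure T} {L : T → E → ℝ} {x : T → E} {ε : ℝ} {k : T → ℝ}
    (hx : NullMeasurable x μ) (hL : IsNormalIntegrand μ L) (hk : Integrable k μ)
    (hlip : ∀ t, LipschitzNear (L t) (x t) ε |k t|)
    (hne : ∀ᵐ t ∂μ, (gateauxSubdiff (L t) (x t)).Nonempty) :
    IsIntegrableSublinear μ (fun t => |k t|)
      fun t => sublinearHull (realDirDeriv (L t) (x t)) where
  nonneg t := abs_nonneg _
  integrable_bound := hk.abs
  measurable v := by
    refine measurable_sublinearHull (T := NullMeasurableSpace T μ) (fun u => ?_) v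
    refine measurable_realDirDeriv (T := NullMeasurableSpace T μ) hlip (fun θ u => ?_) u
    have h1 : Measurable fun t : NullMeasurableSpace T μ => x t + θ • u :=
      (continuous_add_const (θ • u)).measurable.comp hx.measurable'
    exact hL.measurable.comp (measurable_id.prodMk h1)
  sublinear := by
    filter_upwards [hne] with t ⟨ξ, hξ⟩
    exact isSublinear_sublinearHull (isDirectional_realDirDeriv (hlip t))
      ((mem_gateauxSubdiff_iff (hlip t) ξ).1 hξ)

end Subdifferential

end GateauxGelfand

theorem mainTheorem7 {E : Type*} [NormedAddCommGroup E] [NormedSpace ℝ E] [CompleteSpace E]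
    [TopologicalSpace.SeparableSpace E] [MeasurableSpace E] [BorelSpace E]
    (I : Set ℝ) (hI : IsCompact I)
    (x : I → E) (hx : NullMeasurable x (GateauxGelfand.lebesgueOn I))
    (L : I → E → ℝ)
    (hLmeas : ∀ y : E, NullMeasurable (fun t => L t y) (GateauxGelfand.lebesgueOn I))
    (hLlip : ∃ ε : ℝ, 0 < ε ∧ ∃ k : I → ℝ, Integrable k (GateauxGelfand.lebesgueOn I) ∧
      ∀ t : I, ∀ y ∈ Metric.ball (x t) ε, ∀ z ∈ Metric.ball (x t) ε,
        |L t y - L t z| ≤ k t * ‖y - z‖)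
    (hLnormal : GateauxGelfand.IsNormalIntegrand (GateauxGelfand.lebesgueOn I) L)
    (hne : ∀ᵐ t ∂(GateauxGelfand.lebesgueOn I), (GateauxGelfand.gateauxSubdiff (L t) (x t)).Nonempty) :
    GateauxGelfand.GelfandIntegrable (GateauxGelfand.lebesgueOn I)
        (fun t => GateauxGelfand.gateauxSubdiff (L t) (x t)) ∧
      IsCompact (GateauxGelfand.gelfandIntegral (GateauxGelfand.lebesgueOn I)
        (fun t => GateauxGelfand.gateauxSubdiff (L t) (x t))) ∧
      Convex ℝ (GateauxGelfand.gelfandIntegral (GateauxGelfand.lebesgueOn I)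
        (fun t => GateauxGelfand.gateauxSubdiff (L t) (x t))) ∧
      ∀ v : E,
        GateauxGelfand.supportFn v (GateauxGelfand.gelfandIntegral (GateauxGelfand.lebesgueOn I)
            (fun t => GateauxGelfand.gateauxSubdiff (L t) (x t))) =
          ((∫ t : I, (GateauxGelfand.supportFn v
            (GateauxGelfand.gateauxSubdiff (L t) (x t))).toReal ∂(GateauxGelfand.lebesgueOn I) : ℝ) : EReal) := by
  obtain ⟨ε, hε, k, hk, hlip⟩ := hLlip
  have hlip' : ∀ t, GateauxGelfand.LipschitzNear (L t) (x t) ε |k t| := fun t =>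
    ⟨hε, fun y hy z hz => (hlip t y hy z hz).trans
      (mul_le_mul_of_nonneg_right (le_abs_self _) (norm_nonneg _))⟩
  have hp := GateauxGelfand.isIntegrableSublinear_hull hx hLnormal hk hlip' hne
  have heq : ∀ᵐ t ∂(GateauxGelfand.lebesgueOn I), GateauxGelfand.gateauxSubdiff (L t) (x t) =
      GateauxGelfand.minorants
        (fun t => GateauxGelfand.sublinearHull (GateauxGelfand.realDirDeriv (L t) (x t))) t := by
    filter_upwards [hne] with t ⟨ξ, hξ⟩
    exact GateauxGelfand.gateauxSubdiff_eq_minorants (hlip' t) hξ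
  rw [GateauxGelfand.gelfandIntegral_congr heq]
  refine ⟨hp.gelfandIntegrable.congr heq, hp.isCompact_gelfandIntegral,
    GateauxGelfand.convex_gelfandIntegral_minorants _ _, fun v => ?_⟩
  rw [hp.supportFn_gelfandIntegral, ← hp.integral_supportFn]
  congr 1
  refine integral_congr_ae ?_
  filter_upwards [heq] with t ht
  rw [ht]
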